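/- Let $\mathcal A$ be a C*-algebra (not necessarily unital) and let $\mathcal B$ be a C*-subalgebra of $\mathcal A$ that contains a bounded approximate identity for $\mathcal A$. For $A\in\mathcal A$ put $L(A)=\inf\{\|A-B\| : B\in\mathcal B\}$. A $*$-representation $(\mathcal H,\pi)$ of $\mathcal A$ on a Hilbert space is called non-degenerate if $\pi(\mathcal A)\mathcal H$ spans a dense subspace of $\mathcal H$; write $[S,T]=ST-TS$. (1) For every $A\in\mathcal A$ there are a non-degenerate $*$-representation $(\mathcal H,\pi)$ of $\mathcal A$ and a Hermitian unitary operator $U$ on $\mathcal H$ such that $[U,\pi(B)]=0$ for all $B\in\mathcal B$ and $$L(A)=\tfrac12\,\|[U,\pi(A)]\|.$$ (2) $L$ is the (pointwise) supremum of the seminorms $L_{(\mathcal H,\pi,U)}(C)=\tfrac12\|[U,\pi(C)]\|$, $C\in\mathcal A$, as $(\mathcal H,\pi,U)$ ranges over all non-degenerate $*$-representations $(\mathcal H,\pi)$ of $\mathcal A$ and all Hermitian unitary operators $U$ on $\mathcal H$ such that $[U,\pi(B)]=0$ for all $B\in\mathcal B$. (3) Each seminorm $L_{(\mathcal H,\pi,U)}$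 is Leibniz, and so is $L$: that is, $L(AC)\le L(A)\|C\|+\|A\|L(C)$ for all $A,C\in\mathcal A$, and likewise for $L_{(\mathcal H,\pi,U)}$. (4) If $\mathcal A$ is unital and $1_{\mathcal A}\in\mathcal B$, then $L$ is strongly Leibniz: $L$ is Leibniz, $L(1_{\mathcal A})=0$, and $L(A^{-1})\le\|A^{-1}\|^2L(A)$ for every invertible $A\in\mathcal A$. -/

import Mathlib

open Filter

universe u v

namespace CStarDist

/-- A net (here: a filter) of elements of `B`, bounded in norm, that is a two-sided approximate
identity for the whole algebra `A`. -/
def ContainsBoundedApproximateIdentity {A : Type u} [NonUnitalCStarAlgebra A]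
    (B : NonUnitalStarSubalgebra ℂ A) : Prop :=
  ∃ l : Filter A, l.IsApproximateUnit ∧ (∀ᶠ e in l, e ∈ B) ∧ ∃ M : ℝ, ∀ᶠ e in l, ‖e‖ ≤ M

section QuotientSeminorm

variable {A : Type u} [NonUnitalCStarAlgebra A] (B : NonUnitalStarSubalgebra ℂ A)

theorem bddBelow_norm_sub (a : A) : BddBelow (Set.range fun b : B => ‖a - (b : A)‖) :=
  ⟨0, by rintro _ ⟨b, rfl⟩; exact norm_nonneg _⟩

theorem iInf_norm_sub_add_le (a c : A) :
    (⨅ b : B, ‖a + c - (b : A)‖) ≤ (⨅ b : B, ‖a - (b : A)‖) + ⨅ b : B, ‖c - (b : A)‖ := by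
  refine le_ciInf_add_ciInf fun b b' => ?_
  refine (ciInf_le (bddBelow_norm_sub B (a + c)) (b + b')).trans ?_
  have h : a + c - ((b + b' : B) : A) = (a - b) + (c - b') := by
    push_cast
    abel
  rw [h]
  exact norm_add_le _ _

theorem iInf_norm_sub_smul_le (t : ℂ) (a : A) :
    (⨅ b : B, ‖t • a - (b : A)‖) ≤ ‖t‖ * ⨅ b : B, ‖a - (b : A)‖ := by
  rw [Real.mul_iInf_of_nonneg (norm_nonneg t)]
  refine le_ciInf fun b => (ciInf_le (bddBelow_norm_sub B (t • a)) (t • b)).trans ?_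
  rw [← norm_smul, smul_sub]
  exact le_of_eq rfl

theorem iInf_norm_sub_zero : (⨅ b : B, ‖(0 : A) - (b : A)‖) = 0 :=
  le_antisymm ((ciInf_le (bddBelow_norm_sub B 0) 0).trans (by simp))
    (le_ciInf fun _ => norm_nonneg _)

/-- The seminorm `L(a) = inf {‖a - b‖ : b ∈ B}`. -/
noncomputable def quotientSeminorm : Seminorm ℂ A :=
  Seminorm.ofSMulLE (fun a => ⨅ b : B, ‖a - (b : A)‖) (iInf_norm_sub_zero B)
    (iInf_norm_sub_add_le B) (iInf_norm_sub_smul_le B)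

end QuotientSeminorm

/-- A `*`-representation is non-degenerate if the vectors `π(a)ξ` span a dense subspace. -/
def IsNondegenerate {A : Type u} [NonUnitalCStarAlgebra A] {H : Type v} [NormedAddCommGroup H]
    [InnerProductSpace ℂ H] [CompleteSpace H] (π : A →⋆ₙₐ[ℂ] (H →L[ℂ] H)) : Prop :=
  (Submodule.span ℂ {x : H | ∃ (a : A) (ξ : H), π a ξ = x}).topologicalClosure = ⊤

/-- A triple `(H, π, U)`: a non-degenerate `*`-representation `π` of `A` on a Hilbert space `H`, and
a Hermitian unitary operator `U` on `H` with `[U, π(b)] = 0` for all `b ∈ B`. -/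
structure Triple {A : Type u} [NonUnitalCStarAlgebra A] (B : NonUnitalStarSubalgebra ℂ A) where
  H : Type v
  [normed : NormedAddCommGroup H]
  [inner : InnerProductSpace ℂ H]
  [complete : CompleteSpace H]
  π : A →⋆ₙₐ[ℂ] (H →L[ℂ] H)
  nondegenerate : IsNondegenerate π
  U : H →L[ℂ] H
  hermitian : IsSelfAdjoint U
  unitary_mem : U ∈ unitary (H →L[ℂ] H)
  commutes : ∀ b ∈ B, ⁅U, π b⁆ = 0

attribute [instance] Triple.normed Triple.inner Triple.complete

/-- The seminorm `L_(H, π, U)(c) = (1/2) ‖[U, π(c)]‖`. -/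
noncomputable def Triple.seminorm {A : Type u} [NonUnitalCStarAlgebra A]
    {B : NonUnitalStarSubalgebra ℂ A} (T : Triple.{u, v} B) : Seminorm ℂ A :=
  Seminorm.of (fun c => (1 / 2 : ℝ) * ‖⁅T.U, T.π c⁆‖)
    (fun c d => by
      have h : ⁅T.U, T.π (c + d)⁆ = ⁅T.U, T.π c⁆ + ⁅T.U, T.π d⁆ := by
        rw [map_add, Ring.lie_def, Ring.lie_def, Ring.lie_def, mul_add, add_mul]
        abel
      rw [h, ← mul_add]
      exact mul_le_mul_of_nonneg_left (norm_add_le _ _) (by norm_num))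
    (fun t c => by
      have h : ⁅T.U, T.π (t • c)⁆ = t • ⁅T.U, T.π c⁆ := by
        rw [map_smul, Ring.lie_def, Ring.lie_def, mul_smul_comm, smul_mul_assoc, smul_sub]
      rw [h, norm_smul]
      ring)

/-- The Leibniz inequality for a seminorm on a C*-algebra. -/
def IsLeibniz {A : Type u} [NonUnitalCStarAlgebra A] (L : Seminorm ℂ A) : Prop :=
  ∀ a c : A, L (a * c) ≤ L a * ‖c‖ + ‖a‖ * L c

/-- `e` is a (then the unique) identity element of `A`. -/
def IsIdentity {A : Type u} [NonUnitalCStarAlgebra A] (e : A) : Prop :=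
  ∀ a : A, e * a = a ∧ a * e = a

/-- The strong Leibniz property on a C*-algebra with identity element `e`; here `a'` is the inverse
of an invertible element `a`. -/
def IsStronglyLeibniz {A : Type u} [NonUnitalCStarAlgebra A] (e : A) (L : Seminorm ℂ A) : Prop :=
  IsLeibniz L ∧ L e = 0 ∧
    ∀ a a' : A, a * a' = e → a' * a = e → L a' ≤ ‖a'‖ ^ 2 * L a

end CStarDist

/-!
The Hahn–Banach theorem gives a linear functional `f` on `A` with `|f| ≤ L`, hence `f = 0` on `B`,
and `f(a) = L(a)`. Every functional of norm at most one is a matrix coefficient `f = ⟪η, π(·)ξ⟫` of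
a cyclic representation, with vectors of norm at most one: separating the strict epigraph of the
norm from the cone of the pairs `(x⋆ x, |f x|²)` yields a contractive positive functional `φ` with
`|f x|² ≤ φ(x⋆ x)`, so that `f` is bounded on the GNS space of `φ`. Let `P` be the projection onto
the closure of `π(B)ξ`. It commutes with `π(B)`, it kills `η`, and `π(a)Pξ = π(a)ξ` because this
holds for `a ∈ AB`; therefore `L(a) = |⟪η, π(a)Pξ⟫| = |⟪η, [P, π(a)]Pξ⟫| ≤ ‖[P, π(a)]‖`, and
`U = 2P - 1` is the required unitary.
-/

namespace CStarDist

section HahnBanach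

theorem exists_linearMap_eq_and_norm_le_seminorm {𝕜 E : Type*} [RCLike 𝕜] [AddCommGroup E]
    [Module 𝕜 E] (p : Seminorm 𝕜 E) (x : E) :
    ∃ f : E →ₗ[𝕜] 𝕜, f x = (p x : 𝕜) ∧ ∀ y, ‖f y‖ ≤ p y := by
  let : SeminormedAddCommGroup E := p.toAddGroupSeminorm.toSeminormedAddCommGroup
  let : NormedSpace 𝕜 E := ⟨fun c y => (map_smul_eq_mul p c y).le⟩
  obtain ⟨g, hg, hgx⟩ := exists_dual_vector'' 𝕜 x
  exact ⟨g, hgx, fun y => (g.le_of_opNorm_le hg y).trans_eq (one_mul _)⟩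

theorem exists_continuousLinearMap_le_norm_and_le_of_convexCone {E : Type*}
    [SeminormedAddCommGroup E] [NormedSpace ℝ E] (C : ConvexCone ℝ (E × ℝ)) (hC₀ : 0 ∈ C)
    (hC : ∀ p ∈ C, p.2 ≤ ‖p.1‖) :
    ∃ ψ : E →L[ℝ] ℝ, (∀ x, ψ x ≤ ‖x‖) ∧ ∀ p ∈ C, p.2 ≤ ψ p.1 := by
  let S : Set (E × ℝ) := {p | p.1 ∈ Set.univ ∧ ‖p.1‖ < p.2}
  have hS_convex : Convex ℝ S := convexOn_univ_norm.convex_strict_epigraph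
  have hS_open : IsOpen S := by
    simpa only [S, Set.mem_univ, true_and] using isOpen_lt continuous_fst.norm continuous_snd
  have hSC : Disjoint S C := Set.disjoint_left.2 fun p hpS hpC => (hC p hpC).not_gt hpS.2
  obtain ⟨F, t, hFS, hFC⟩ := geometric_hahn_banach_open hS_convex hS_open C.convex hSC
  have ht : t ≤ 0 := by simpa using hFC 0 hC₀
  have hF_nonneg : ∀ p ∈ C, 0 ≤ F p := by
    intro p hp
    by_contra! hneg
    have hscale := hFC _ (C.smul_mem (div_pos_of_neg_of_neg (by linarith : t - 1 < 0) hneg) hp)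
    rw [map_smul, smul_eq_mul, div_mul_cancel₀ _ hneg.ne] at hscale
    linarith
  let c : ℝ := -F (0, 1)
  have hc : 0 < c := neg_pos.2 ((hFS (0, 1) (by simp [S])).trans_le ht)
  let ψ : E →L[ℝ] ℝ := c⁻¹ • F.comp (ContinuousLinearMap.inl ℝ E ℝ)
  have hF : ∀ p : E × ℝ, F p = c * (ψ p.1 - p.2) := by
    intro p
    have hp : p = (p.1, 0) + p.2 • (0, 1) := by simp
    calc F p = F (p.1, 0) + p.2 * F (0, 1) := by
          conv_lhs => rw [hp, map_add, map_smul, smul_eq_mul]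
      _ = c * (ψ p.1 - p.2) := by
          simp only [ψ, smul_apply, ContinuousLinearMap.comp_apply, ContinuousLinearMap.inl_apply,
            smul_eq_mul, mul_sub, mul_inv_cancel_left₀ hc.ne']
          simp only [c]
          ring
  refine ⟨ψ, fun x => le_of_forall_gt_imp_ge_of_dense fun r hr => ?_, fun p hp => ?_⟩
  · have hneg : c * (ψ x - r) < 0 := hF (x, r) ▸ (hFS (x, r) ⟨Set.mem_univ x, hr⟩).trans_le ht
    exact (sub_neg.1 (neg_of_mul_neg_right hneg hc.le)).le
  · exact sub_nonneg.1 (nonneg_of_mul_nonneg_right (hF p ▸ hF_nonneg p hp) hc)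

end HahnBanach

section PositiveMajorant

open scoped ComplexOrder

theorem star_add_mul_add_le {R : Type*} [NonUnitalRing R] [StarRing R] [PartialOrder R]
    [StarOrderedRing R] [Module ℝ R] [IsScalarTower ℝ R R] [SMulCommClass ℝ R R] [StarModule ℝ R]
    [PosSMulMono ℝ R] {p q : ℝ} (hp : 0 < p) (hq : 0 < q) (x y : R) :
    star (x + y) * (x + y) ≤ (p + q) • (p⁻¹ • (star x * x) + q⁻¹ • (star y * y)) := by
  have hnonneg : 0 ≤ (p * q)⁻¹ • (star (q • x - p • y) * (q • x - p • y)) :=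
    smul_nonneg (by positivity) (star_mul_self_nonneg _)
  rw [← sub_nonneg]
  refine hnonneg.trans_eq ?_
  simp only [star_sub, star_add, star_smul, star_trivial, sub_mul, mul_sub, add_mul, mul_add,
    smul_mul_assoc, mul_smul_comm]
  match_scalars <;> field_simp <;> ring

variable {A : Type u} [NonUnitalCStarAlgebra A] [PartialOrder A] [StarOrderedRing A]

theorem exists_positiveLinearMap_eq_on_star_mul_self (ψ : A →ₗ[ℝ] ℝ)
    (hψ : ∀ a, 0 ≤ ψ (star a * a)) :
    ∃ φ : A →ₚ[ℂ] ℂ, ∀ a, φ (star a * a) = ψ (star a * a) := by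
  let ψ_re : A →ₗ[ℝ] ℝ := ψ ∘ₗ (selfAdjoint.submodule ℝ A).subtype ∘ₗ realPart
  have hψ_re_apply : ∀ x, ψ_re x = ψ (realPart x : A) := fun _ => rfl
  have h_selfAdjoint : ∀ x : A, IsSelfAdjoint x →
      Module.Dual.extendRCLike (𝕜 := ℂ) ψ_re x = ψ x := by
    intro x hx
    rw [Module.Dual.extendRCLike_apply, hψ_re_apply, hψ_re_apply, hx.coe_realPart]
    simp [realPart_I_smul, hx.imaginaryPart]
  have h_eq : ∀ a, Module.Dual.extendRCLike (𝕜 := ℂ) ψ_re (star a * a) = ψ (star a * a) :=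
    fun a => h_selfAdjoint _ (IsSelfAdjoint.star_mul_self a)
  refine ⟨PositiveLinearMap.mk₀ (Module.Dual.extendRCLike ψ_re) fun x hx => ?_, h_eq⟩
  obtain ⟨a, rfl⟩ := CStarAlgebra.nonneg_iff_eq_star_mul_self.1 hx
  rw [h_eq]
  exact_mod_cast hψ a

theorem star_add_mul_add_le_smul_add {x y s t : A} {p q : ℝ} (hp : 0 ≤ p) (hq : 0 ≤ q)
    (hs : 0 ≤ s) (ht : 0 ≤ t) (hx : star x * x ≤ p • s) (hy : star y * y ≤ q • t) :
    star (x + y) * (x + y) ≤ (p + q) • (s + t) := by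
  have eq_zero : ∀ {z r : A}, star z * z ≤ (0 : ℝ) • r → z = 0 := fun hz =>
    (CStarRing.star_mul_self_eq_zero_iff _).1
      ((hz.trans_eq (zero_smul ℝ _)).antisymm (star_mul_self_nonneg _))
  rcases hp.eq_or_lt with rfl | hp
  · rw [eq_zero hx, zero_add, zero_add, smul_add]
    exact hy.trans (le_add_of_nonneg_left (smul_nonneg hq hs))
  rcases hq.eq_or_lt with rfl | hq
  · rw [eq_zero hy, add_zero, add_zero, smul_add]
    exact hx.trans (le_add_of_nonneg_right (smul_nonneg hp.le ht))
  calc star (x + y) * (x + y)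
      ≤ (p + q) • (p⁻¹ • (star x * x) + q⁻¹ • (star y * y)) := star_add_mul_add_le hp hq x y
    _ ≤ (p + q) • (s + t) := by
        gcongr
        · exact (inv_smul_le_iff_of_pos hp).2 hx
        · exact (inv_smul_le_iff_of_pos hq).2 hy

/-- A convex cone containing the pairs `(a⋆ a, ‖f a‖²)`, cut out by an inequality rather than
described by generators. -/
def majorantCone (f : A →ₗ[ℂ] ℂ) : ConvexCone ℝ (A × ℝ) where
  carrier := {p | 0 ≤ p.1 ∧ 0 ≤ p.2 ∧ ∃ x : A, f x = (p.2 : ℂ) ∧ star x * x ≤ p.2 • p.1}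
  smul_mem' := by
    rintro c hc ⟨s, r⟩ ⟨hs, hr, x, hx, hle⟩
    refine ⟨smul_nonneg hc.le hs, mul_nonneg hc.le hr, c • x, ?_, ?_⟩
    · rw [← Complex.coe_smul, map_smul, hx]
      simp
    · calc star (c • x) * (c • x) = (c * c) • (star x * x) := by
            rw [star_smul, star_trivial, smul_mul_smul_comm]
        _ ≤ (c * c) • r • s := smul_le_smul_of_nonneg_left hle (mul_self_nonneg c)
        _ = (c * r) • c • s := by module
  add_mem' := by
    rintro ⟨s, r⟩ ⟨hs, hr, x, hx, hle⟩ ⟨s', r'⟩ ⟨hs', hr', x', hx', hle'⟩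
    exact ⟨add_nonneg hs hs', add_nonneg hr hr', x + x', by simp [hx, hx'],
      star_add_mul_add_le_smul_add hr hr' hs hs' hle hle'⟩

theorem le_norm_of_mem_majorantCone {f : A →ₗ[ℂ] ℂ} (hf : ∀ a, ‖f a‖ ≤ ‖a‖) {p : A × ℝ}
    (hp : p ∈ majorantCone f) : p.2 ≤ ‖p.1‖ := by
  obtain ⟨s, r⟩ := p
  obtain ⟨-, hr : 0 ≤ r, x, hx : f x = r, hle : star x * x ≤ r • s⟩ := hp
  change r ≤ ‖s‖
  rcases hr.eq_or_lt with rfl | hr_pos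
  · exact norm_nonneg s
  have hrx : r ≤ ‖x‖ := by simpa [hx, abs_of_nonneg hr] using hf x
  refine le_of_mul_le_mul_left ?_ hr_pos
  calc r * r ≤ ‖x‖ * ‖x‖ := mul_self_le_mul_self hr hrx
    _ = ‖star x * x‖ := CStarRing.norm_star_mul_self.symm
    _ ≤ ‖r • s‖ := CStarAlgebra.norm_le_norm_of_nonneg_of_le (star_mul_self_nonneg x) hle
    _ = r * ‖s‖ := by rw [norm_smul, Real.norm_of_nonneg hr]

theorem star_mul_self_mem_majorantCone (f : A →ₗ[ℂ] ℂ) (a : A) :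
    (star a * a, ‖f a‖ ^ 2) ∈ majorantCone f := by
  refine ⟨star_mul_self_nonneg a, sq_nonneg _, star (f a) • a, ?_, ?_⟩
  · simpa using Complex.conj_mul' (f a)
  · rw [star_smul, star_star, smul_mul_smul_comm, ← Complex.coe_smul, Complex.star_def,
      Complex.mul_conj']
    simp

theorem exists_positiveLinearMap_norm_sq_le {f : A →ₗ[ℂ] ℂ} (hf : ∀ a, ‖f a‖ ≤ ‖a‖) :
    ∃ φ : A →ₚ[ℂ] ℂ, (∀ a, (φ (star a * a)).re ≤ ‖a‖ ^ 2) ∧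
      ∀ a, ‖f a‖ ^ 2 ≤ (φ (star a * a)).re := by
  have hzero : 0 ∈ majorantCone f := by
    simpa [← Prod.zero_eq_mk] using star_mul_self_mem_majorantCone f 0
  obtain ⟨ψ, hψ_le, hψ_ge⟩ := exists_continuousLinearMap_le_norm_and_le_of_convexCone
    (majorantCone f) hzero fun p hp => le_norm_of_mem_majorantCone hf hp
  have hfψ : ∀ a, ‖f a‖ ^ 2 ≤ ψ (star a * a) := fun a =>
    hψ_ge _ (star_mul_self_mem_majorantCone f a)
  obtain ⟨φ, hφ⟩ := exists_positiveLinearMap_eq_on_star_mul_self ψ.toLinearMap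
    fun a => (sq_nonneg _).trans (hfψ a)
  have hφψ : ∀ a, (φ (star a * a)).re = ψ (star a * a) := fun a => by
    rw [hφ, Complex.ofReal_re, ContinuousLinearMap.coe_coe]
  refine ⟨φ, fun a => ?_, fun a => (hfψ a).trans_eq (hφψ a).symm⟩
  rw [hφψ, sq, ← CStarRing.norm_star_mul_self]
  exact hψ_le _

end PositiveMajorant

section CyclicRepresentation

open scoped ComplexOrder InnerProductSpace

theorem exists_inner_eq_of_denseRange {𝕜 E H : Type*} [RCLike 𝕜] [AddCommGroup E] [Module 𝕜 E]
    [NormedAddCommGroup H] [InnerProductSpace 𝕜 H] [CompleteSpace H] {j : E →ₗ[𝕜] H}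
    (hj : DenseRange j) {g : E →ₗ[𝕜] 𝕜} {M : ℝ} (hM : 0 ≤ M) (hg : ∀ x, ‖g x‖ ≤ M * ‖j x‖) :
    ∃ η : H, ‖η‖ ≤ M ∧ ∀ x, ⟪η, j x⟫_𝕜 = g x := by
  refine ⟨(InnerProductSpace.toDual 𝕜 H).symm (g.extendOfNorm j), ?_, fun x => ?_⟩
  · rw [LinearIsometryEquiv.norm_map]
    exact LinearMap.opNorm_extendOfNorm_le hj hM hg
  · rw [InnerProductSpace.toDual_symm_apply]
    exact LinearMap.extendOfNorm_eq hj ⟨M, hg⟩ x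

section GNS

variable {A : Type u} [NonUnitalCStarAlgebra A] [PartialOrder A] [StarOrderedRing A]

/-- The canonical map of `A` into the Hilbert space of the GNS representation of `φ`. -/
noncomputable def toGNS (φ : A →ₚ[ℂ] ℂ) : A →ₗ[ℂ] φ.GNS :=
  UniformSpace.Completion.toComplₗᵢ.toLinearMap ∘ₗ φ.toPreGNS.toLinearMap

theorem denseRange_toGNS (φ : A →ₚ[ℂ] ℂ) : DenseRange (toGNS φ) :=
  UniformSpace.Completion.denseRange_coe.comp φ.toPreGNS.surjective.denseRange
    (UniformSpace.Completion.continuous_coe _)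

theorem inner_toGNS (φ : A →ₚ[ℂ] ℂ) (a b : A) : ⟪toGNS φ a, toGNS φ b⟫_ℂ = φ (star a * b) :=
  UniformSpace.Completion.inner_coe _ _

theorem norm_toGNS_sq (φ : A →ₚ[ℂ] ℂ) (a : A) : ‖toGNS φ a‖ ^ 2 = (φ (star a * a)).re := by
  rw [← inner_toGNS, inner_self_eq_norm_sq_to_K]
  norm_cast

theorem gnsNonUnitalStarAlgHom_toGNS (φ : A →ₚ[ℂ] ℂ) (a b : A) :
    φ.gnsNonUnitalStarAlgHom a (toGNS φ b) = toGNS φ (a * b) :=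
  φ.gnsNonUnitalStarAlgHom_apply_coe

variable {φ : A →ₚ[ℂ] ℂ}

theorem norm_toGNS_le (hφ : ∀ a, (φ (star a * a)).re ≤ ‖a‖ ^ 2) (a : A) :
    ‖toGNS φ a‖ ≤ ‖a‖ :=
  le_of_sq_le_sq ((norm_toGNS_sq φ a).trans_le (hφ a)) (norm_nonneg a)

theorem norm_apply_le_norm_toGNS (hφ : ∀ a, (φ (star a * a)).re ≤ ‖a‖ ^ 2) (a : A) :
    ‖φ a‖ ≤ ‖toGNS φ a‖ := by
  have hl := CStarAlgebra.increasingApproximateUnit A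
  have := hl.neBot
  have hlim : Tendsto (fun e => ‖φ (e * a)‖) (CStarAlgebra.approximateUnit A) (nhds ‖φ a‖) :=
    (((map_continuous φ).tendsto a).comp (hl.tendsto_mul_right a)).norm
  refine le_of_tendsto hlim ?_
  filter_upwards [hl.eventually_star_eq, hl.eventually_norm] with e he_star he_norm
  calc ‖φ (e * a)‖ = ‖⟪toGNS φ e, toGNS φ a⟫_ℂ‖ := by rw [inner_toGNS, he_star]
    _ ≤ ‖toGNS φ e‖ * ‖toGNS φ a‖ := norm_inner_le_norm _ _
    _ ≤ ‖toGNS φ a‖ := mul_le_of_le_one_left (norm_nonneg _) ((norm_toGNS_le hφ e).trans he_norm)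

theorem exists_gnsNonUnitalStarAlgHom_apply_eq_toGNS (hφ : ∀ a, (φ (star a * a)).re ≤ ‖a‖ ^ 2) :
    ∃ ξ : φ.GNS, ‖ξ‖ ≤ 1 ∧ ∀ a, φ.gnsNonUnitalStarAlgHom a ξ = toGNS φ a := by
  obtain ⟨ξ, hξ, hξφ⟩ := exists_inner_eq_of_denseRange (denseRange_toGNS φ)
    (g := φ.toLinearMap) zero_le_one fun a => by
      simpa using norm_apply_le_norm_toGNS hφ a
  refine ⟨ξ, hξ, fun a => (denseRange_toGNS φ).eq_of_inner_left ℂ fun b => ?_⟩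
  calc ⟪φ.gnsNonUnitalStarAlgHom a ξ, toGNS φ b⟫_ℂ
      = ⟪ξ, φ.gnsNonUnitalStarAlgHom (star a) (toGNS φ b)⟫_ℂ := by
        rw [map_star, ContinuousLinearMap.star_eq_adjoint,
          ContinuousLinearMap.adjoint_inner_right]
    _ = φ (star a * b) := by rw [gnsNonUnitalStarAlgHom_toGNS]; exact hξφ _
    _ = ⟪toGNS φ a, toGNS φ b⟫_ℂ := (inner_toGNS φ a b).symm

end GNS

theorem exists_cyclic_representation_eq_inner {A : Type u} [NonUnitalCStarAlgebra A]
    {f : A →ₗ[ℂ] ℂ} (hf : ∀ a, ‖f a‖ ≤ ‖a‖) :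
    ∃ (H : Type u) (_ : NormedAddCommGroup H) (_ : InnerProductSpace ℂ H) (_ : CompleteSpace H)
      (π : A →⋆ₙₐ[ℂ] (H →L[ℂ] H)) (ξ η : H), DenseRange (fun a => π a ξ) ∧
      ‖ξ‖ ≤ 1 ∧ ‖η‖ ≤ 1 ∧ ∀ a, f a = ⟪η, π a ξ⟫_ℂ := by
  let := CStarAlgebra.spectralOrder A
  have := CStarAlgebra.spectralOrderedRing A
  obtain ⟨φ, hφ, hfφ⟩ := exists_positiveLinearMap_norm_sq_le hf
  have hf_le : ∀ a, ‖f a‖ ≤ 1 * ‖toGNS φ a‖ := fun a => by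
    rw [one_mul]
    exact le_of_sq_le_sq ((hfφ a).trans_eq (norm_toGNS_sq φ a).symm) (norm_nonneg _)
  obtain ⟨η, hη, hηf⟩ := exists_inner_eq_of_denseRange (denseRange_toGNS φ) zero_le_one hf_le
  obtain ⟨ξ, hξ, hπξ⟩ := exists_gnsNonUnitalStarAlgHom_apply_eq_toGNS hφ
  refine ⟨φ.GNS, inferInstance, inferInstance, inferInstance, φ.gnsNonUnitalStarAlgHom, ξ, η,
    ?_, hξ, hη, fun a => ?_⟩
  · simpa only [hπξ] using denseRange_toGNS φ
  · rw [hπξ, hηf]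

end CyclicRepresentation

section Seminorms

variable {A : Type u} [NonUnitalCStarAlgebra A] {B : NonUnitalStarSubalgebra ℂ A}

theorem quotientSeminorm_le_norm_sub (a : A) {b : A} (hb : b ∈ B) :
    quotientSeminorm B a ≤ ‖a - b‖ :=
  ciInf_le (bddBelow_norm_sub B a) ⟨b, hb⟩

theorem quotientSeminorm_le_norm (a : A) : quotientSeminorm B a ≤ ‖a‖ := by
  simpa using quotientSeminorm_le_norm_sub a (zero_mem B)

theorem quotientSeminorm_eq_zero_of_mem {b : A} (hb : b ∈ B) : quotientSeminorm B b = 0 :=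
  le_antisymm (by simpa using quotientSeminorm_le_norm_sub b hb) (apply_nonneg _ _)

theorem IsLeibniz.of_isLUB {ι : Type*} {p : ι → Seminorm ℂ A} {L : Seminorm ℂ A}
    (hL : ∀ c, IsLUB (Set.range fun i => p i c) (L c)) (hp : ∀ i, IsLeibniz (p i)) :
    IsLeibniz L := by
  have hpL : ∀ i c, p i c ≤ L c := fun i c => (hL c).1 ⟨i, rfl⟩
  refine fun a c => (hL (a * c)).2 ?_
  rintro _ ⟨i, rfl⟩
  calc p i (a * c) ≤ p i a * ‖c‖ + ‖a‖ * p i c := hp i a c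
    _ ≤ L a * ‖c‖ + ‖a‖ * L c := by gcongr <;> exact hpL _ _

theorem IsStronglyLeibniz.of_isLUB {ι : Type*} {p : ι → Seminorm ℂ A} {L : Seminorm ℂ A} {e : A}
    (hL : ∀ c, IsLUB (Set.range fun i => p i c) (L c)) (hp : ∀ i, IsStronglyLeibniz e (p i)) :
    IsStronglyLeibniz e L := by
  refine ⟨.of_isLUB hL fun i => (hp i).1, le_antisymm ((hL e).2 ?_) (apply_nonneg L e),
    fun a a' h h' => (hL a').2 ?_⟩
  · rintro _ ⟨i, rfl⟩
    exact (hp i).2.1.le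
  · rintro _ ⟨i, rfl⟩
    calc p i a' ≤ ‖a'‖ ^ 2 * p i a := (hp i).2.2 a a' h h'
      _ ≤ ‖a'‖ ^ 2 * L a := by gcongr; exact (hL a).1 ⟨i, rfl⟩

end Seminorms

section Triple

theorem lie_mul_eq {R : Type*} [Ring R] (u x y : R) : ⁅u, x * y⁆ = ⁅u, x⁆ * y + x * ⁅u, y⁆ := by
  simp only [Ring.lie_def]
  noncomm_ring

variable {A : Type u} [NonUnitalCStarAlgebra A] {B : NonUnitalStarSubalgebra ℂ A}

namespace Triple

variable (T : Triple.{u, v} B)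

theorem seminorm_apply (c : A) : T.seminorm c = (1 / 2 : ℝ) * ‖⁅T.U, T.π c⁆‖ := rfl

theorem norm_π_le (a : A) : ‖T.π a‖ ≤ ‖a‖ :=
  NonUnitalStarAlgHom.norm_apply_le T.π a

theorem seminorm_le_norm (c : A) : T.seminorm c ≤ ‖c‖ := by
  have h : ‖⁅T.U, T.π c⁆‖ ≤ ‖T.π c‖ + ‖T.π c‖ := by
    rw [Ring.lie_def]
    refine (norm_sub_le _ _).trans_eq ?_
    rw [CStarRing.norm_mem_unitary_mul _ T.unitary_mem,
      CStarRing.norm_mul_mem_unitary _ T.unitary_mem]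
  rw [seminorm_apply]
  linarith [T.norm_π_le c]

theorem seminorm_eq_zero_of_mem {b : A} (hb : b ∈ B) : T.seminorm b = 0 := by
  rw [seminorm_apply, T.commutes b hb, norm_zero, mul_zero]

theorem seminorm_le (c : A) : T.seminorm c ≤ quotientSeminorm B c := by
  refine le_ciInf fun b => ?_
  calc T.seminorm c ≤ T.seminorm (c - b) + T.seminorm b := by
        simpa using map_add_le_add T.seminorm (c - b) b
    _ = T.seminorm (c - b) := by rw [T.seminorm_eq_zero_of_mem b.2, add_zero]
    _ ≤ ‖c - b‖ := T.seminorm_le_norm _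

theorem lie_π_mul (a c : A) :
    ⁅T.U, T.π (a * c)⁆ = ⁅T.U, T.π a⁆ * T.π c + T.π a * ⁅T.U, T.π c⁆ := by
  rw [map_mul, lie_mul_eq]

theorem isLeibniz_seminorm : IsLeibniz T.seminorm := by
  intro a c
  have h : ‖⁅T.U, T.π (a * c)⁆‖ ≤ ‖⁅T.U, T.π a⁆‖ * ‖c‖ + ‖a‖ * ‖⁅T.U, T.π c⁆‖ := by
    rw [T.lie_π_mul]
    exact norm_add_le_of_le (norm_mul_le_of_le le_rfl (T.norm_π_le c))
      (norm_mul_le_of_le (T.norm_π_le a) le_rfl)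
  simp only [seminorm_apply]
  linarith

theorem lie_π_inverse {e : A} (he : IsIdentity e) (heB : e ∈ B) {a a' : A} (h : a * a' = e)
    (h' : a' * a = e) : ⁅T.U, T.π a'⁆ = -(T.π a' * ⁅T.U, T.π a⁆ * T.π a') := by
  have h_left : ⁅T.U, T.π a'⁆ = T.π e * ⁅T.U, T.π a'⁆ := by
    have h_mul := T.lie_π_mul e a'
    rwa [(he a').1, T.commutes e heB, zero_mul, zero_add] at h_mul
  have h_sum : ⁅T.U, T.π a⁆ * T.π a' + T.π a * ⁅T.U, T.π a'⁆ = 0 := by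
    rw [← T.lie_π_mul, h, T.commutes e heB]
  rw [h_left, ← h', map_mul, mul_assoc, eq_neg_of_add_eq_zero_right h_sum, mul_neg, mul_assoc]

theorem isStronglyLeibniz_seminorm {e : A} (he : IsIdentity e) (heB : e ∈ B) :
    IsStronglyLeibniz e T.seminorm := by
  refine ⟨T.isLeibniz_seminorm, T.seminorm_eq_zero_of_mem heB, fun a a' h h' => ?_⟩
  have hle : ‖⁅T.U, T.π a'⁆‖ ≤ ‖a'‖ * ‖⁅T.U, T.π a⁆‖ * ‖a'‖ := by
    rw [T.lie_π_inverse he heB h h', norm_neg]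
    exact norm_mul_le_of_le (norm_mul_le_of_le (T.norm_π_le a') le_rfl) (T.norm_π_le a')
  simp only [seminorm_apply]
  linarith

end Triple

end Triple

section DistanceFormula

open scoped InnerProductSpace Pointwise

variable {A : Type u} [NonUnitalCStarAlgebra A] {B : NonUnitalStarSubalgebra ℂ A}

theorem commute_starProjection_of_star_invariant {𝕜 H : Type*} [RCLike 𝕜] [NormedAddCommGroup H]
    [InnerProductSpace 𝕜 H] [CompleteSpace H] {K : Submodule 𝕜 H} [K.HasOrthogonalProjection]
    {T : H →L[𝕜] H} (hT : ∀ x ∈ K, T x ∈ K) (hT' : ∀ x ∈ K, star T x ∈ K) :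
    Commute K.starProjection T := by
  refine (ContinuousLinearMap.IsIdempotentElem.commute_iff K.isIdempotentElem_starProjection).2
    ⟨?_, ?_⟩
  · rw [Submodule.range_starProjection]
    exact hT
  · rw [Submodule.ker_starProjection]
    exact ContinuousLinearMap.orthogonal_mem_invtSubmodule hT'

theorem norm_inner_le_norm_lie_starProjection {𝕜 H : Type*} [RCLike 𝕜] [NormedAddCommGroup H]
    [InnerProductSpace 𝕜 H] {K : Submodule 𝕜 H} [K.HasOrthogonalProjection] (T : H →L[𝕜] H)
    {ξ η : H} (hξ : ξ ∈ K) (hη : η ∈ Kᗮ) :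
    ‖⟪η, T ξ⟫_𝕜‖ ≤ ‖η‖ * (‖⁅K.starProjection, T⁆‖ * ‖ξ‖) := by
  have h_lie : ⁅K.starProjection, T⁆ ξ = K.starProjection (T ξ) - T ξ := by
    rw [Ring.lie_def, sub_apply, mul_apply_eq_comp, mul_apply_eq_comp,
      Submodule.starProjection_eq_self_iff.2 hξ]
  have h_inner : ⟪η, ⁅K.starProjection, T⁆ ξ⟫_𝕜 = -⟪η, T ξ⟫_𝕜 := by
    rw [h_lie, inner_sub_right,
      Submodule.inner_left_of_mem_orthogonal (K.starProjection_apply_mem _) hη, zero_sub]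
  calc ‖⟪η, T ξ⟫_𝕜‖ = ‖⟪η, ⁅K.starProjection, T⁆ ξ⟫_𝕜‖ := by rw [h_inner, norm_neg]
    _ ≤ ‖η‖ * ‖⁅K.starProjection, T⁆ ξ‖ := norm_inner_le_norm _ _
    _ ≤ ‖η‖ * (‖⁅K.starProjection, T⁆‖ * ‖ξ‖) := by
      gcongr
      exact ContinuousLinearMap.le_opNorm _ _

theorem lie_two_mul_sub_one {R : Type*} [Ring R] (p x : R) :
    ⁅2 * p - 1, x⁆ = ⁅p, x⁆ + ⁅p, x⁆ := by
  simp only [Ring.lie_def]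
  noncomm_ring

variable {H : Type v} [NormedAddCommGroup H] [InnerProductSpace ℂ H] [CompleteSpace H]
  {π : A →⋆ₙₐ[ℂ] (H →L[ℂ] H)}

theorem isNondegenerate_of_denseRange {ξ : H} (hξ : DenseRange fun a => π a ξ) :
    IsNondegenerate π := by
  refine Submodule.dense_iff_topologicalClosure_eq_top.1 (hξ.mono ?_)
  rintro _ ⟨a, rfl⟩
  exact Submodule.subset_span ⟨a, ξ, rfl⟩

theorem commute_starProjection_of_invariant {K : Submodule ℂ H} [K.HasOrthogonalProjection]
    (hK : ∀ b ∈ B, ∀ x ∈ K, π b x ∈ K) {b : A} (hb : b ∈ B) :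
    Commute K.starProjection (π b) := by
  refine commute_starProjection_of_star_invariant (hK b hb) fun x hx => ?_
  rw [← map_star]
  exact hK (star b) (star_mem hb) x hx

/-- The triple formed by a non-degenerate representation `π` and the reflection in a closed subspace
which is invariant under `π(B)`. -/
noncomputable def Triple.ofReflection (hπ : IsNondegenerate π) (K : Submodule ℂ H)
    [K.HasOrthogonalProjection] (hK : ∀ b ∈ B, ∀ x ∈ K, π b x ∈ K) : Triple.{u, v} B where
  H := H
  π := π
  nondegenerate := hπ
  U := 2 * K.starProjection - 1
  hermitian := by
    rw [two_mul]
    exact ((isSelfAdjoint_starProjection K).add (isSelfAdjoint_starProjection K)).sub (.one _)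
  unitary_mem := isStarProjection_starProjection.two_mul_sub_one_mem_unitary
  commutes b hb := by
    rw [lie_two_mul_sub_one, (commute_starProjection_of_invariant hK hb).lie_eq, add_zero]

theorem Triple.seminorm_ofReflection (hπ : IsNondegenerate π) (K : Submodule ℂ H)
    [K.HasOrthogonalProjection] (hK : ∀ b ∈ B, ∀ x ∈ K, π b x ∈ K) (c : A) :
    (Triple.ofReflection hπ K hK).seminorm c = ‖⁅K.starProjection, π c⁆‖ := by
  change (1 / 2 : ℝ) * ‖⁅2 * K.starProjection - 1, π c⁆‖ = _
  rw [lie_two_mul_sub_one, ← two_smul ℝ, norm_smul, Real.norm_two]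
  ring

/-- The continuous linear map `a ↦ π(a)ξ`. -/
noncomputable def orbitMap (π : A →⋆ₙₐ[ℂ] (H →L[ℂ] H)) (ξ : H) : A →L[ℂ] H :=
  ContinuousLinearMap.apply ℂ H ξ ∘L LinearMap.mkContinuous π 1 fun a =>
    (NonUnitalStarAlgHom.norm_apply_le π a).trans_eq (one_mul _).symm

theorem orbitMap_apply (ξ : H) (a : A) : orbitMap π ξ a = π a ξ := rfl

variable (B) in
/-- The closure of the subspace `π(B)ξ`. -/
noncomputable def orbitClosure (π : A →⋆ₙₐ[ℂ] (H →L[ℂ] H)) (ξ : H) : Submodule ℂ H :=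
  (B.toSubmodule.map (orbitMap π ξ).toLinearMap).topologicalClosure

instance (ξ : H) : CompleteSpace (orbitClosure B π ξ) :=
  (Submodule.isClosed_topologicalClosure _).completeSpace_coe

theorem apply_mem_orbitClosure {b : A} (hb : b ∈ B) (ξ : H) : π b ξ ∈ orbitClosure B π ξ :=
  Submodule.le_topologicalClosure _ ⟨b, hb, rfl⟩

theorem orbitClosure_invariant (ξ : H) :
    ∀ b ∈ B, ∀ x ∈ orbitClosure B π ξ, π b x ∈ orbitClosure B π ξ := by
  refine fun b hb x hx => map_mem_closure (π b).continuous hx ?_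
  rintro _ ⟨c, hc, rfl⟩
  exact ⟨b * c, B.mul_mem hb hc, by simp [orbitMap_apply]⟩

theorem mem_orthogonal_orbitClosure {ξ η : H} (h : ∀ b ∈ B, ⟪η, π b ξ⟫_ℂ = 0) :
    η ∈ (orbitClosure B π ξ)ᗮ := by
  rw [orbitClosure, Submodule.orthogonal_closure, Submodule.mem_orthogonal']
  rintro _ ⟨b, hb, rfl⟩
  exact h b hb

theorem apply_starProjection_orbitClosure
    (hBA : Dense (Submodule.span ℂ (Set.univ * (B : Set A)) : Set A)) (ξ : H) (a : A) :
    π a ((orbitClosure B π ξ).starProjection ξ) = π a ξ := by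
  set P := (orbitClosure B π ξ).starProjection
  suffices orbitMap π (P ξ) = orbitMap π ξ from DFunLike.congr_fun this a
  refine ContinuousLinearMap.ext_on hBA ?_
  rintro _ ⟨c, -, b, hb, rfl⟩
  have hb_fix : π b (P ξ) = π b ξ := calc
    π b (P ξ) = P (π b ξ) := DFunLike.congr_fun
      (commute_starProjection_of_invariant (orbitClosure_invariant ξ) hb).eq.symm ξ
    _ = π b ξ := Submodule.starProjection_eq_self_iff.2 (apply_mem_orbitClosure hb ξ)
  simp only [orbitMap_apply, map_mul, mul_apply_eq_comp, hb_fix]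

variable (B) in
theorem exists_annihilating_functional (a : A) :
    ∃ f : A →ₗ[ℂ] ℂ, f a = (quotientSeminorm B a : ℂ) ∧ (∀ b ∈ B, f b = 0) ∧
      ∀ c, ‖f c‖ ≤ ‖c‖ := by
  obtain ⟨f, hfa, hf⟩ := exists_linearMap_eq_and_norm_le_seminorm (quotientSeminorm B) a
  refine ⟨f, hfa, fun b hb => ?_, fun c => (hf c).trans (quotientSeminorm_le_norm c)⟩
  exact norm_le_zero_iff.1 ((hf b).trans_eq (quotientSeminorm_eq_zero_of_mem hb))

theorem exists_seminorm_eq_quotientSeminorm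
    (hBA : Dense (Submodule.span ℂ (Set.univ * (B : Set A)) : Set A)) (a : A) :
    ∃ T : Triple.{u, u} B, T.seminorm a = quotientSeminorm B a := by
  obtain ⟨f, hfa, hfB, hf⟩ := exists_annihilating_functional B a
  obtain ⟨H, _, _, _, π, ξ, η, hdense, hξ, hη, hfπ⟩ := exists_cyclic_representation_eq_inner hf
  let K := orbitClosure B π ξ
  let T := Triple.ofReflection (isNondegenerate_of_denseRange hdense) K (orbitClosure_invariant ξ)
  have hη_mem : η ∈ Kᗮ := mem_orthogonal_orbitClosure fun b hb => (hfπ b).symm.trans (hfB b hb)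
  have hPξ : ‖K.starProjection ξ‖ ≤ 1 := (K.norm_starProjection_apply_le ξ).trans hξ
  refine ⟨T, (T.seminorm_le a).antisymm ?_⟩
  calc quotientSeminorm B a = ‖f a‖ := by
        rw [hfa, Complex.norm_real, Real.norm_of_nonneg (apply_nonneg _ _)]
    _ = ‖⟪η, π a (K.starProjection ξ)⟫_ℂ‖ := by
        rw [hfπ, apply_starProjection_orbitClosure hBA]
    _ ≤ ‖η‖ * (‖⁅K.starProjection, π a⁆‖ * ‖K.starProjection ξ‖) :=
        norm_inner_le_norm_lie_starProjection _ (K.starProjection_apply_mem ξ) hη_mem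
    _ ≤ 1 * (‖⁅K.starProjection, π a⁆‖ * 1) := by gcongr
    _ = T.seminorm a := by rw [one_mul, mul_one, Triple.seminorm_ofReflection]

theorem isLUB_seminorm (hBA : Dense (Submodule.span ℂ (Set.univ * (B : Set A)) : Set A)) (c : A) :
    IsLUB (Set.range fun T : Triple.{u, u} B => T.seminorm c) (quotientSeminorm B c) := by
  obtain ⟨T, hT⟩ := exists_seminorm_eq_quotientSeminorm hBA c
  refine IsGreatest.isLUB ⟨⟨T, hT⟩, ?_⟩
  rintro _ ⟨S, rfl⟩
  exact S.seminorm_le c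

theorem ContainsBoundedApproximateIdentity.dense_span_mul
    (hBA : ContainsBoundedApproximateIdentity B) :
    Dense (Submodule.span ℂ (Set.univ * (B : Set A)) : Set A) := by
  obtain ⟨l, hl, hlB, -⟩ := hBA
  have := hl.neBot
  refine fun a => mem_closure_of_tendsto (hl.tendsto_mul_left a) ?_
  filter_upwards [hlB] with e he
  exact Submodule.subset_span (Set.mul_mem_mul (Set.mem_univ a) he)

end DistanceFormula

end CStarDist

open CStarDist Pointwise in
theorem theorem3p2_general {A : Type u} [NonUnitalCStarAlgebra A] (B : NonUnitalStarSubalgebra ℂ A)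
    (hBA : Dense (Submodule.span ℂ (Set.univ * (B : Set A)) : Set A)) :
    (∀ a : A, ∃ T : Triple.{u, u} B, quotientSeminorm B a = (1 / 2 : ℝ) * ‖⁅T.U, T.π a⁆‖) ∧
    (∀ c : A, IsLUB (Set.range fun T : Triple.{u, u} B => T.seminorm c) (quotientSeminorm B c)) ∧
    (∀ (T : Triple.{u, v} B) (c : A), T.seminorm c ≤ quotientSeminorm B c) ∧
    (∀ T : Triple.{u, v} B, IsLeibniz T.seminorm) ∧
    IsLeibniz (quotientSeminorm B) ∧
    (∀ e : A, IsIdentity e → e ∈ B → IsStronglyLeibniz e (quotientSeminorm B)) := by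
  have hLUB := isLUB_seminorm hBA
  refine ⟨fun a => ?_, hLUB, fun T => T.seminorm_le, fun T => T.isLeibniz_seminorm,
    .of_isLUB hLUB fun T => T.isLeibniz_seminorm,
    fun e he heB => .of_isLUB hLUB fun T => T.isStronglyLeibniz_seminorm he heB⟩
  obtain ⟨T, hT⟩ := exists_seminorm_eq_quotientSeminorm hBA a
  exact ⟨T, hT.symm⟩

theorem theorem3p2 {A : Type u} [NonUnitalCStarAlgebra A] (B : NonUnitalStarSubalgebra ℂ A)
    (hB : IsClosed (B : Set A)) (hBA : CStarDist.ContainsBoundedApproximateIdentity B) :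
    -- the distance formula
    (∀ a : A, ∃ T : CStarDist.Triple.{u, u} B, CStarDist.quotientSeminorm B a = (1 / 2 : ℝ) * ‖⁅T.U, T.π a⁆‖) ∧
    -- `L` is the supremum of the seminorms `L_(H, π, U)`; Hilbert spaces in any other universe
    -- give nothing larger
    (∀ c : A, IsLUB (Set.range fun T : CStarDist.Triple.{u, u} B => T.seminorm c) (CStarDist.quotientSeminorm B c)) ∧
    (∀ (T : CStarDist.Triple.{u, v} B) (c : A), T.seminorm c ≤ CStarDist.quotientSeminorm B c) ∧
    -- the Leibniz property
    (∀ T : CStarDist.Triple.{u, v} B, CStarDist.IsLeibniz T.seminorm) ∧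
    CStarDist.IsLeibniz (CStarDist.quotientSeminorm B) ∧
    -- the unital case
    (∀ e : A, CStarDist.IsIdentity e → e ∈ B → CStarDist.IsStronglyLeibniz e (CStarDist.quotientSeminorm B)) :=
  theorem3p2_general B hBA.dense_span_mul
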